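/- Let $\mathscr H$ be a separable complex Hilbert space and let $\mathbb B(\mathscr H)$ be the algebra of bounded operators on it, with identity $I$. Let $\mathbb D$ be the open unit disk. For $T\in\mathbb B(\mathscr H)$ with spectrum $\sigma(T)\subset\mathbb D$ put $d_T=\operatorname{dist}(\partial\mathbb D,\sigma(T))$. Let $\mathfrak A$ be the set of all analytic functions $f:\mathbb D\to\mathbb C$ with $\operatorname{Re} f>0$ on $\mathbb D$ and $f(0)=1$. For $T\in\mathbb B(\mathscr H)$ let $s_n(T)=\inf\{\|T-F\| : F\in\mathbb B(\mathscr H),\ \operatorname{rank}F\le n\}$, $n=0,1,2,\dots$; for compact $T$ these are the singular values of $T$, that is, the eigenvalues of $|T|=(T^*T)^{1/2}$ in decreasing order, repeated according to multiplicity. Let $|||\cdot|||$ be a unitarily invariant norm, i.e. $|||T|||=\sup_n\Phi(s_0(T),\dots,s_{n-1}(T),0,0,\dots)\in[0,\infty]$, where $\Phi$ is a symmetric norming function (a norm on the finitely supported real sequences that is invariant under permutations and sign changes of the entries). Let $A,B\in\mathbb B(\mathscr H)$ be normal operators with $\sigma(A)\cup\sigma(B)\subset\mathbb D$ and let $f\in\mathfrak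 A$. Then $$|||f(A)+\bar f(B)|||\le\frac{2}{d_Ad_B}\,|||I-AB^*|||,$$ where $f(A)=\frac1{2\pi i}\oint_{|z|=r} f(z)(z-A)^{-1}\,dz$ is the Riesz--Dunford integral ($r<1$, with $\sigma(A)$ inside the circle) and $\bar f(B)$ is obtained by applying the continuous function $z\mapsto\overline{f(z)}$ to the normal operator $B$ (so $\bar f(B)=f(B)^*$). In particular, for $B=A$, $$|||\operatorname{Re} f(A)|||\le\frac1{d_A^2}\,|||I-AA^*|||,\qquad \operatorname{Re} f(A)=\tfrac12\big(f(A)+f(A)^*\big).$$ -/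

import Mathlib

noncomputable section

/-- A symmetric norming function: a norm on the space of finitely supported real sequences that is
invariant under permutations of the entries and depends only on their absolute values. (The usual
normalization `Φ (1, 0, 0, …) = 1` is not required, so every positive multiple is allowed too.) -/
structure SymmetricNormingFunction where
  toFun : (ℕ →₀ ℝ) → ℝ
  pos : ∀ x, x ≠ 0 → 0 < toFun x
  smul : ∀ (c : ℝ) (x : ℕ →₀ ℝ), toFun (c • x) = |c| * toFun x
  add_le : ∀ x y, toFun (x + y) ≤ toFun x + toFun y
  perm : ∀ (σ : Equiv.Perm ℕ) (x : ℕ →₀ ℝ), toFun (Finsupp.equivMapDomain σ x) = toFun x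
  abs_inv : ∀ x y : ℕ →₀ ℝ, (∀ i, |x i| = |y i|) → toFun x = toFun y

section Operators

variable {H : Type*} [NormedAddCommGroup H] [InnerProductSpace ℂ H]

/-- The singular values of a bounded operator, indexed from `0`: `singVal T n` is the distance of
`T` to the operators of rank at most `n`. For compact `T` these are the eigenvalues of
`|T| = (T* T)^(1/2)` in decreasing order, repeated according to multiplicity, and then `0`. -/
def singVal (T : H →L[ℂ] H) (n : ℕ) : ℝ :=
  sInf {c : ℝ | ∃ F : H →L[ℂ] H, LinearMap.rank (F : H →ₗ[ℂ] H) ≤ (n : Cardinal) ∧ ‖T - F‖ = c}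

/-- The finitely supported sequence `(s₀(T), …, sₙ₋₁(T), 0, 0, …)`. -/
def truncSingVal (T : H →L[ℂ] H) (n : ℕ) : ℕ →₀ ℝ :=
  ∑ i ∈ Finset.range n, Finsupp.single i (singVal T i)

/-- The unitarily invariant norm `|||T||| = Φ(s₀(T), s₁(T), …) ∈ [0, ∞]` attached to `Φ`, where
`Φ` of an infinite sequence is the supremum of its values at the finite truncations. -/
def uiNorm (Φ : SymmetricNormingFunction) (T : H →L[ℂ] H) : ENNReal :=
  ⨆ n : ℕ, ENNReal.ofReal (Φ.toFun (truncSingVal T n))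

/-- `d_T = dist(∂𝔻, σ(T))`, the infimum of `|z - w|` over `|z| = 1` and `w ∈ σ(T)`. -/
def distCircle (T : H →L[ℂ] H) : ℝ :=
  sInf {c : ℝ | ∃ z ∈ Metric.sphere (0 : ℂ) 1, ∃ w ∈ spectrum ℂ T, dist z w = c}

/-- The Riesz-Dunford integral `(2πi)⁻¹ ∮ f(z) (z - T)⁻¹ dz` over the positively oriented circle
`|z| = r`. -/
def rieszDunford (f : ℂ → ℂ) (T : H →L[ℂ] H) (r : ℝ) : H →L[ℂ] H :=
  (2 * Real.pi * Complex.I : ℂ)⁻¹ • ∮ z in C(0, r), f z • resolvent T z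

/-- `f(T)` for `f` analytic on the open unit disk and `σ(T)` inside it: the Riesz-Dunford integral
over the circle about `0` whose radius is halfway between the spectral radius of `T` and `1`.
Every other admissible circle gives the same operator, see `rieszDunford_eq_analyticCalc`. -/
def analyticCalc (f : ℂ → ℂ) (T : H →L[ℂ] H) : H →L[ℂ] H :=
  rieszDunford f T ((1 + (spectralRadius ℂ T).toReal) / 2)

end Operators

/-- The class `𝔄` of the functions that are analytic on the open unit disk, have positive real part
there and take the value `1` at `0`. (Values outside of the disk are irrelevant.) -/
def classA : Set (ℂ → ℂ) :=
  {f | AnalyticOnNhd ℂ f (Metric.ball 0 1) ∧ (∀ z ∈ Metric.ball (0 : ℂ) 1, 0 < (f z).re) ∧ f 0 = 1}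

theorem rieszDunford_eq_of_le {H : Type*} [NormedAddCommGroup H] [InnerProductSpace ℂ H]
    [CompleteSpace H] {f : ℂ → ℂ} (hf : AnalyticOnNhd ℂ f (Metric.ball 0 1)) {T : H →L[ℂ] H}
    {r s : ℝ} (hr : 0 < r) (hT : spectrum ℂ T ⊆ Metric.ball 0 r) (hrs : r ≤ s) (hs : s < 1) :
    rieszDunford f T s = rieszDunford f T r := by
  have key : ∀ z ∈ Metric.closedBall (0 : ℂ) s \ Metric.ball 0 r,
      DifferentiableAt ℂ (fun z => f z • resolvent T z) z := by
    intro z hz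
    have h1 : z ∈ Metric.ball (0 : ℂ) 1 := Metric.closedBall_subset_ball hs hz.1
    have h2 : z ∈ resolventSet ℂ T := by
      by_contra h
      exact hz.2 (hT h)
    exact (hf z h1).differentiableAt.smul (spectrum.hasDerivAt_resolvent_const_left h2).differentiableAt
  unfold rieszDunford
  congr 1
  refine Complex.circleIntegral_eq_of_differentiable_on_annulus_off_countable hr hrs
    Set.countable_empty (fun z hz => (key z hz).continuousAt.continuousWithinAt) ?_
  intro z hz
  refine key z ⟨Metric.ball_subset_closedBall hz.1.1, fun h => hz.1.2 ?_⟩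
  exact Metric.ball_subset_closedBall h

/-- `f(T)` does not depend on the choice of the circle. -/
theorem rieszDunford_eq_analyticCalc {H : Type*} [NormedAddCommGroup H] [InnerProductSpace ℂ H]
    [CompleteSpace H] {f : ℂ → ℂ} (hf : AnalyticOnNhd ℂ f (Metric.ball 0 1)) {T : H →L[ℂ] H}
    {r : ℝ} (hr : 0 < r) (hr1 : r < 1) (hT : spectrum ℂ T ⊆ Metric.ball 0 r) :
    rieszDunford f T r = analyticCalc f T := by
  have hle : spectralRadius ℂ T ≤ ENNReal.ofReal r := by
    refine iSup₂_le fun k hk => ?_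
    have h := hT hk
    rw [mem_ball_zero_iff] at h
    rw [← ENNReal.ofReal_coe_nnreal, coe_nnnorm]
    exact ENNReal.ofReal_le_ofReal h.le
  have hne : spectralRadius ℂ T ≠ ⊤ := ne_top_of_le_ne_top ENNReal.ofReal_ne_top hle
  have hρ : (spectralRadius ℂ T).toReal ≤ r := ENNReal.toReal_le_of_le_ofReal hr.le hle
  have h0 : 0 ≤ (spectralRadius ℂ T).toReal := ENNReal.toReal_nonneg
  have hT' : spectrum ℂ T ⊆ Metric.ball 0 ((1 + (spectralRadius ℂ T).toReal) / 2) := by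
    intro k hk
    have h : (‖k‖₊ : ENNReal) ≤ spectralRadius ℂ T := le_iSup₂ (f := fun k _ => (‖k‖₊ : ENNReal)) k hk
    have h' := ENNReal.toReal_mono hne h
    rw [ENNReal.coe_toReal, coe_nnnorm] at h'
    rw [mem_ball_zero_iff]
    linarith
  unfold analyticCalc
  rcases le_total r ((1 + (spectralRadius ℂ T).toReal) / 2) with h | h
  · exact (rieszDunford_eq_of_le hf hr hT h (by linarith)).symm
  · exact rieszDunford_eq_of_le hf (by linarith) hT' h hr1

end

/-! If `g` is analytic on the disk, continuous up to the circle and `g 0 = 1`, Herglotz's formula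
writes `g(w)` as the mean over `|z| = 1` of `Re g(z) (z+w)/(z-w)`. Applied to `A` and `B`, it makes
`g(A) + g(B)*` the mean of `Re g(z)` times a sum of two Herglotz transforms. Algebra collapses that
sum to `2 (z-A)⁻¹ (1 - A B*) ((z-B)⁻¹)*` (`herglotz_add_eq`). The resolvents have norm at most
`1/d_A` and `1/d_B`, and `Re g ≥ 0` has mean `Re g(0) = 1`, so averaging preserves the bound. A
general `f` is reached through its dilations `f(t·)`, `t → 1`.

The estimate is run on the continuous linear functionals `pairing e W`, which commute with means and
limits. With `e` orthonormal and `‖W‖ ≤ 1` they are bounded by the Ky Fan sums `s₀ + … + s_{m-1}`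
(`norm_pairing_mul_mul_le`) and conversely control them (`sum_singVal_le_of_pairing_le`). The
outcome is a weak majorization of singular values, which every symmetric norming function respects
(`le_of_sum_range_le`). -/

/-! ### Weak majorization and symmetric norming functions. -/

theorem sum_range_mul_nonneg_of_antitoneOn {n : ℕ} {b d : ℕ → ℝ}
    (hb : ∀ i j, i ≤ j → j < n → b j ≤ b i) (hb0 : ∀ i < n, 0 ≤ b i)
    (hd : ∀ k ≤ n, 0 ≤ ∑ i ∈ Finset.range k, d i) :
    0 ≤ ∑ i ∈ Finset.range n, b i * d i := by
  -- Abel summation as an induction: lowering the weight from `b k` to `b (k+1)` only decreases the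
  -- left side, the partial sum of `d` being nonnegative.
  have key : ∀ k < n, b k * ∑ i ∈ Finset.range (k + 1), d i
      ≤ ∑ i ∈ Finset.range (k + 1), b i * d i := by
    intro k
    induction k with
    | zero => intro _; simp
    | succ k ih =>
      intro hk
      have h1 := ih (by omega)
      have h2 := hb k (k + 1) (by omega) hk
      have h3 := mul_le_mul_of_nonneg_right h2 (hd (k + 1) hk.le)
      rw [Finset.sum_range_succ _ (k + 1), Finset.sum_range_succ _ (k + 1), mul_add]
      linarith
  rcases n with _ | n
  · simp
  · exact (mul_nonneg (hb0 n (by omega)) (hd _ le_rfl)).trans (key n (by omega))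

namespace SymmetricNormingFunction

variable (Φ : SymmetricNormingFunction)

theorem map_zero : Φ.toFun 0 = 0 := by
  simpa using Φ.smul 0 0

/-- Hahn–Banach, starting from the line through `x`: a linear functional supporting `Φ` at `x`
reduces majorization to inequalities between weighted sums. -/
theorem exists_linearMap_eq (x : ℕ →₀ ℝ) :
    ∃ g : (ℕ →₀ ℝ) →ₗ[ℝ] ℝ, g x = Φ.toFun x ∧ ∀ y, g y ≤ Φ.toFun y := by
  have hneg : ∀ y, 0 ≤ Φ.toFun y := fun y => by
    rcases eq_or_ne y 0 with rfl | h
    · exact Φ.map_zero.ge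
    · exact (Φ.pos y h).le
  rcases eq_or_ne x 0 with rfl | hx
  · exact ⟨0, by simp [Φ.map_zero], fun y => by simpa using hneg y⟩
  obtain ⟨g, hg, hg'⟩ := exists_extension_of_le_sublinear
    (LinearPMap.mkSpanSingleton (K := ℝ) x (Φ.toFun x) hx) Φ.toFun
    (fun c hc y => by rw [Φ.smul, abs_of_pos hc]) Φ.add_le (by
      rintro ⟨y, hy⟩
      obtain ⟨c, rfl⟩ := Submodule.mem_span_singleton.1 hy
      rw [LinearPMap.mkSpanSingleton'_apply, Φ.smul, smul_eq_mul]
      exact mul_le_mul_of_nonneg_right (le_abs_self c) (hneg x))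
  refine ⟨g, ?_, hg'⟩
  have := hg ⟨x, Submodule.mem_span_singleton_self x⟩
  rw [this, LinearPMap.mkSpanSingleton_apply]

/-- A permutation of the indices below `n` along which the values of `a` decrease. -/
theorem _root_.exists_perm_antitone (a : ℕ → ℝ) (n : ℕ) :
    ∃ σ : Equiv.Perm ℕ, (∀ i, n ≤ i → σ i = i) ∧ ∀ i j, i ≤ j → j < n → a (σ j) ≤ a (σ i) := by
  let τ : Equiv.Perm (Fin n) := Tuple.sort fun i : Fin n => -a i
  have hτ : Monotone ((fun i : Fin n => -a i) ∘ τ) := Tuple.monotone_sort _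
  have hval : ∀ (i : ℕ) (h : i < n),
      (τ.extendDomain Fin.equivSubtype) i = (τ ⟨i, h⟩ : Fin n) := by
    intro i h
    exact Equiv.Perm.extendDomain_apply_subtype τ Fin.equivSubtype h
  refine ⟨τ.extendDomain Fin.equivSubtype, fun i hi => ?_, fun i j hij hj => ?_⟩
  · exact Equiv.Perm.extendDomain_apply_not_subtype τ Fin.equivSubtype (not_lt.2 hi)
  · rw [hval i (by omega), hval j hj]
    have := hτ (show (⟨i, by omega⟩ : Fin n) ≤ ⟨j, hj⟩ from hij)
    simpa using this

/-- Weak majorization implies domination under every symmetric norming function. -/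
theorem le_of_sum_range_le {n : ℕ} {x y : ℕ → ℝ} (hx : Antitone x) (hx0 : ∀ i, 0 ≤ x i)
    (h : ∀ k ≤ n, ∑ i ∈ Finset.range k, x i ≤ ∑ i ∈ Finset.range k, y i) :
    Φ.toFun (∑ i ∈ Finset.range n, Finsupp.single i (x i))
      ≤ Φ.toFun (∑ i ∈ Finset.range n, Finsupp.single i (y i)) := by
  obtain ⟨g, hg, hg'⟩ := Φ.exists_linearMap_eq (∑ i ∈ Finset.range n, Finsupp.single i (x i))
  set a : ℕ → ℝ := fun i => g (Finsupp.single i 1) with ha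
  have hsingle : ∀ i c, g (Finsupp.single i c) = c * a i := fun i c => by
    rw [← mul_one c, ← smul_eq_mul, ← Finsupp.smul_single, map_smul, smul_eq_mul, smul_eq_mul,
      mul_one]
  obtain ⟨σ, hσn, hσ⟩ := exists_perm_antitone (fun i => |a i|) n
  let s : ℕ → ℝ := fun i => if 0 ≤ a i then 1 else -1
  have hs : ∀ i, s i * a i = |a i| := fun i => by
    by_cases h : 0 ≤ a i
    · simp [s, h, abs_of_nonneg h]
    · simp [s, h, abs_of_neg (not_le.1 h)]
  have hs1 : ∀ i, |s i| = 1 := fun i => by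
    by_cases h : 0 ≤ a i <;> simp [s, h]
  -- Permuting and changing signs in `y` leaves `Φ` unchanged, and makes `g` pair `y i` with the
  -- `i`-th largest of the `|a j|`, `j < n`.
  set z : ℕ →₀ ℝ := ∑ i ∈ Finset.range n, Finsupp.single (σ i) (s (σ i) * y i) with hz
  have hΦz : Φ.toFun z = Φ.toFun (∑ i ∈ Finset.range n, Finsupp.single i (y i)) := by
    rw [← Φ.perm σ (∑ i ∈ Finset.range n, Finsupp.single i (y i))]
    refine Φ.abs_inv _ _ fun j => ?_
    have : z j = s j * (Finsupp.equivMapDomain σ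
        (∑ i ∈ Finset.range n, Finsupp.single i (y i))) j := by
      rw [hz, Finsupp.equivMapDomain_apply, Finsupp.finsetSum_apply, Finsupp.finsetSum_apply,
        Finset.mul_sum]
      refine Finset.sum_congr rfl fun i _ => ?_
      by_cases hij : σ i = j
      · subst hij; simp
      · have : i ≠ σ.symm j := fun h => hij (by simp [h])
        simp [hij, this]
    rw [this, abs_mul, hs1, one_mul]
  have h1 : ∑ i ∈ Finset.range n, x i * a i ≤ ∑ i ∈ Finset.range n, |a i| * x i :=
    Finset.sum_le_sum fun i _ => by
      rw [mul_comm]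
      exact mul_le_mul_of_nonneg_right (le_abs_self _) (hx0 i)
  -- Rearrangement inequality: `x` and `|a ∘ σ|` decrease together.
  have h2 : ∑ i ∈ Finset.range n, |a i| * x i ≤ ∑ i ∈ Finset.range n, |a (σ i)| * x i := by
    have hmono : MonovaryOn (fun i => |a (σ i)|) x (Finset.range n) := by
      intro i hi j hj hij
      have hji : j ≤ i := by
        by_contra hcon
        exact absurd (hx (not_le.1 hcon).le) (not_le.2 hij)
      exact hσ j i hji (by simpa using hi)
    have := hmono.sum_comp_perm_smul_le_sum_smul (σ := σ⁻¹) (by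
      intro i hi
      by_contra hcon
      exact hi (Equiv.Perm.inv_eq_iff_eq.2 (hσn i (by simpa using hcon)).symm))
    simpa using this
  have h3 : 0 ≤ ∑ i ∈ Finset.range n, |a (σ i)| * (y i - x i) :=
    sum_range_mul_nonneg_of_antitoneOn hσ (fun _ _ => abs_nonneg _) fun k hk => by
      rw [Finset.sum_sub_distrib]
      linarith [h k hk]
  have h4 : g z = ∑ i ∈ Finset.range n, |a (σ i)| * y i := by
    rw [hz, map_sum]
    refine Finset.sum_congr rfl fun i _ => ?_
    rw [hsingle, ← hs]
    ring
  simp only [mul_sub, Finset.sum_sub_distrib] at h3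
  calc _ = ∑ i ∈ Finset.range n, x i * a i := by
        rw [← hg, map_sum]; exact Finset.sum_congr rfl fun i _ => hsingle _ _
    _ ≤ g z := by rw [h4]; linarith
    _ ≤ _ := (hg' z).trans hΦz.le

end SymmetricNormingFunction

/-! ### Singular values and the upper Ky Fan bound. -/

section SingVal

variable {H : Type*} [NormedAddCommGroup H] [InnerProductSpace ℂ H]

theorem singVal_le_norm_sub {T F : H →L[ℂ] H} {n : ℕ}
    (hF : LinearMap.rank (F : H →ₗ[ℂ] H) ≤ (n : Cardinal)) : singVal T n ≤ ‖T - F‖ :=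
  csInf_le ⟨0, by rintro _ ⟨F, -, rfl⟩; exact norm_nonneg _⟩ ⟨F, hF, rfl⟩

theorem singVal_nonneg (T : H →L[ℂ] H) (n : ℕ) : 0 ≤ singVal T n :=
  Real.sInf_nonneg (by rintro _ ⟨F, -, rfl⟩; exact norm_nonneg _)

theorem exists_norm_sub_lt_of_singVal_lt {T : H →L[ℂ] H} {n : ℕ} {c : ℝ} (h : singVal T n < c) :
    ∃ F : H →L[ℂ] H, LinearMap.rank (F : H →ₗ[ℂ] H) ≤ (n : Cardinal) ∧ ‖T - F‖ < c := by
  rw [singVal] at h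
  obtain ⟨_, ⟨F, hF, rfl⟩, hc⟩ := exists_lt_of_csInf_lt (by exact ⟨‖T - 0‖, 0, by simp, rfl⟩) h
  exact ⟨F, hF, hc⟩

theorem singVal_antitone (T : H →L[ℂ] H) : Antitone (singVal T) := by
  intro m n hmn
  refine le_of_forall_gt fun c hc => ?_
  obtain ⟨F, hF, hlt⟩ := exists_norm_sub_lt_of_singVal_lt hc
  exact (singVal_le_norm_sub (hF.trans (by exact_mod_cast hmn))).trans_lt hlt

theorem singVal_mul_mul_le (X T Y : H →L[ℂ] H) (n : ℕ) :
    singVal (X * T * Y) n ≤ ‖X‖ * ‖Y‖ * singVal T n := by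
  have key : ∀ F : H →L[ℂ] H, LinearMap.rank (F : H →ₗ[ℂ] H) ≤ (n : Cardinal) →
      singVal (X * T * Y) n ≤ ‖X‖ * ‖Y‖ * ‖T - F‖ := by
    intro F hF
    have hrank : LinearMap.rank ((X * F * Y : H →L[ℂ] H) : H →ₗ[ℂ] H) ≤ (n : Cardinal) :=
      (LinearMap.rank_comp_le_left (Y : H →ₗ[ℂ] H) ((X * F : H →L[ℂ] H) : H →ₗ[ℂ] H)).trans
        ((LinearMap.rank_comp_le_right (F : H →ₗ[ℂ] H) (X : H →ₗ[ℂ] H)).trans hF)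
    refine (singVal_le_norm_sub hrank).trans ?_
    rw [← sub_mul, ← mul_sub]
    calc ‖X * (T - F) * Y‖ ≤ ‖X‖ * ‖T - F‖ * ‖Y‖ :=
          (norm_mul_le _ _).trans (mul_le_mul_of_nonneg_right (norm_mul_le _ _) (norm_nonneg _))
      _ = _ := by ring
  refine le_of_forall_gt_imp_ge_of_dense fun c hc => ?_
  by_cases h0 : ‖X‖ * ‖Y‖ = 0
  · have := key 0 (by simp)
    rw [h0, zero_mul] at this hc
    exact this.trans hc.le
  have hpos : 0 < ‖X‖ * ‖Y‖ := lt_of_le_of_ne (by positivity) (Ne.symm h0)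
  obtain ⟨F, hF, hlt⟩ := exists_norm_sub_lt_of_singVal_lt (T := T) (n := n) (c := c / (‖X‖ * ‖Y‖))
    (by rwa [lt_div_iff₀' hpos])
  rw [lt_div_iff₀' hpos] at hlt
  exact (key F hF).trans hlt.le

/-- From subspaces `M 0, M 1, …` with `dim (M i) > i` one can choose an orthonormal family
`u i ∈ M i`. -/
theorem exists_orthonormal_mem {m : ℕ} (M : ℕ → Submodule ℂ H)
    (hM : ∀ i < m, (i : Cardinal) < Module.rank ℂ (M i)) :
    ∃ u : Fin m → H, Orthonormal ℂ u ∧ ∀ i : Fin m, u i ∈ M i := by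
  induction m with
  | zero => exact ⟨Fin.elim0, ⟨fun i => i.elim0, fun i => i.elim0⟩, fun i => i.elim0⟩
  | succ m ih =>
    obtain ⟨u, hu, huM⟩ := ih fun i hi => hM i (by omega)
    -- The kernel consists of the vectors of `M m` orthogonal to those already chosen; it is nonzero
    -- because `dim (M m) > m`.
    let L : M m →ₗ[ℂ] (Fin m → ℂ) :=
      (LinearMap.pi fun i => (innerSL ℂ (u i) : H →ₗ[ℂ] ℂ)) ∘ₗ (M m).subtype
    have hker : LinearMap.ker L ≠ ⊥ := by
      intro h
      have hinj := LinearMap.ker_eq_bot.1 h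
      have hfin : Module.Finite ℂ (M m) := Module.Finite.of_injective L hinj
      have h1 := LinearMap.finrank_le_finrank_of_injective hinj
      have h2 := hM m (by omega)
      rw [← Module.finrank_eq_rank, Nat.cast_lt] at h2
      simp at h1
      omega
    obtain ⟨⟨x, hxM⟩, hxL, hx0⟩ := Submodule.exists_mem_ne_zero_of_ne_bot hker
    have hx0 : x ≠ 0 := fun h => hx0 (by simp [h])
    have hxu : ∀ i, inner ℂ (u i) x = 0 := fun i => by
      have := congrFun (LinearMap.mem_ker.1 hxL) i
      simpa [L] using this
    refine ⟨Fin.snoc u ((‖x‖ : ℂ)⁻¹ • x), ?_, ?_⟩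
    · rw [orthonormal_iff_ite] at hu ⊢
      intro i j
      refine Fin.lastCases ?_ (fun i => ?_) i <;> refine Fin.lastCases ?_ (fun j => ?_) j
      · have h : ‖(‖x‖ : ℂ)⁻¹ • x‖ = 1 := norm_smul_inv_norm hx0
        rw [Fin.snoc_last, inner_self_eq_norm_sq_to_K, h]
        simp
      · have h : inner ℂ x (u j) = 0 := by rw [← inner_conj_symm, hxu, _root_.map_zero]
        simp [inner_smul_left, h, (Fin.castSucc_lt_last j).ne']
      · simp [inner_smul_right, hxu, (Fin.castSucc_lt_last i).ne]
      · simp [hu i j]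
    · intro i
      refine Fin.lastCases ?_ (fun i => ?_) i
      · simpa using (M m).smul_mem _ hxM
      · simpa using huM i

/-- The diagonal entries of `T` in an orthonormal system of length `m` sum up to at most the sum of
the first `m` singular values. -/
theorem norm_sum_inner_le_sum_singVal [CompleteSpace H] {m : ℕ} {e : Fin m → H}
    (he : Orthonormal ℂ e) (T : H →L[ℂ] H) :
    ‖∑ i, inner ℂ (e i) (T (e i))‖ ≤ ∑ i ∈ Finset.range m, singVal T i := by
  refine le_of_forall_pos_le_add fun ε hε => ?_
  let δ : ℝ := ε / (m + 1)
  have hδ : 0 < δ := by positivity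
  choose F hF hFlt using fun n => exists_norm_sub_lt_of_singVal_lt
    (T := T) (n := n) (c := singVal T n + δ) (by linarith)
  let V : Submodule ℂ H := Submodule.span ℂ (Set.range e)
  have hVfin : FiniteDimensional ℂ V := FiniteDimensional.span_of_finite ℂ (Set.finite_range e)
  have hVrank : Module.finrank ℂ V = m := by
    rw [finrank_span_eq_card he.linearIndependent, Fintype.card_fin]
  have heV : ∀ i, e i ∈ V := fun i => Submodule.subset_span ⟨i, rfl⟩
  have basis : ∀ u : Fin m → V, Orthonormal ℂ u →
      ∃ b : OrthonormalBasis (Fin m) ℂ V, ∀ i, b i = u i := by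
    intro u hu
    exact ⟨OrthonormalBasis.mk hu
      (hu.linearIndependent.span_eq_top_of_card_eq_finrank' (by simp [hVrank])).ge, fun i => by simp⟩
  -- On `V`, of dimension `m`, the kernel of `F (m-1-i)` has dimension at least `i + 1`. The
  -- reversed index makes the kernels grow with `i`, and on `u i` the operator `T` acts as `T - F
  -- (m-1-i)`.
  obtain ⟨u, hu, huM⟩ := exists_orthonormal_mem (m := m) (H := V)
    (fun i => LinearMap.ker ((F (m - 1 - i) : H →ₗ[ℂ] H) ∘ₗ V.subtype)) (by
      intro i hi
      have h1 := LinearMap.finrank_range_add_finrank_ker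
        ((F (m - 1 - i) : H →ₗ[ℂ] H) ∘ₗ V.subtype)
      have h2 := (LinearMap.rank_comp_le_left V.subtype (F (m - 1 - i) : H →ₗ[ℂ] H)).trans
        (hF (m - 1 - i))
      rw [LinearMap.rank, ← Module.finrank_eq_rank, Nat.cast_le] at h2
      rw [← Module.finrank_eq_rank, Nat.cast_lt]
      omega)
  let S : V →ₗ[ℂ] V := (V.orthogonalProjectionOnto : H →ₗ[ℂ] V) ∘ₗ (T : H →ₗ[ℂ] H) ∘ₗ V.subtype
  have hS : ∀ x : V, inner ℂ x (S x) = inner ℂ (x : H) (T x) := fun x => by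
    simp [S]
  obtain ⟨b, hb⟩ := basis u hu
  obtain ⟨b', hb'⟩ := basis (fun i => ⟨e i, heV i⟩) (by
    rw [orthonormal_iff_ite] at he ⊢
    exact he)
  -- Both sums are the trace of the compression of `T` to `V`.
  have htr : ∑ i, inner ℂ (e i) (T (e i)) = ∑ i, inner ℂ (u i : H) (T (u i)) := by
    have := (LinearMap.trace_eq_sum_inner S b').symm.trans (LinearMap.trace_eq_sum_inner S b)
    simpa only [hS, hb, hb'] using this
  rw [htr]
  have hterm : ∀ i : Fin m, ‖inner ℂ (u i : H) (T (u i))‖ ≤ singVal T (m - 1 - i) + δ := by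
    intro i
    have h0 : F (m - 1 - i) (u i : H) = 0 := huM i
    have h1 : T (u i) = (T - F (m - 1 - i)) (u i) := by simp [h0]
    have h2 : ‖(u i : H)‖ = 1 := hu.1 i
    rw [h1]
    calc _ ≤ ‖(u i : H)‖ * ‖(T - F (m - 1 - i)) (u i : H)‖ := norm_inner_le_norm _ _
      _ ≤ 1 * (‖T - F (m - 1 - i)‖ * 1) := by
          rw [h2]
          have := (T - F (m - 1 - i)).le_opNorm (u i : H)
          rw [h2] at this
          linarith
      _ ≤ _ := by linarith [hFlt (m - 1 - i)]
  calc _ ≤ ∑ i : Fin m, (singVal T (m - 1 - i) + δ) :=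
        (norm_sum_le _ _).trans (Finset.sum_le_sum fun i _ => hterm i)
    _ = ∑ i ∈ Finset.range m, singVal T i + m * δ := by
        rw [Finset.sum_add_distrib, Fin.sum_univ_eq_sum_range (fun i => singVal T (m - 1 - i)),
          Finset.sum_range_reflect]
        simp
    _ ≤ _ := by
        have : m * δ ≤ ε := by
          rw [show m * δ = m / (m + 1) * ε by simp only [δ]; ring]
          exact mul_le_of_le_one_left hε.le (by rw [div_le_one (by positivity)]; linarith)
        linarith

/-- The functional `T ↦ ∑ ⟨W e i, T e i⟩`. -/
noncomputable def pairing {m : ℕ} (e : Fin m → H) (W : H →L[ℂ] H) : (H →L[ℂ] H) →L[ℂ] ℂ :=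
  ∑ i, (innerSL ℂ (W (e i))).comp (ContinuousLinearMap.apply ℂ H (e i))

theorem pairing_apply {m : ℕ} (e : Fin m → H) (W T : H →L[ℂ] H) :
    pairing e W T = ∑ i, inner ℂ (W (e i)) (T (e i)) := by
  simp [pairing]

end SingVal

/-! ### The lower Ky Fan bound and Ky Fan dominance. -/

section SingValLower

variable {H : Type*} [NormedAddCommGroup H] [InnerProductSpace ℂ H] [CompleteSpace H]

/-- The norm of `T g(T* T)`. -/
theorem norm_mul_cfc_star_mul_self_le (T : H →L[ℂ] H) {g : ℝ → ℝ} (hg : Continuous g) {b : ℝ}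
    (hb : 0 ≤ b) (h : ∀ t, 0 ≤ t → √t * |g t| ≤ b) : ‖T * cfc g (star T * T)‖ ≤ b := by
  have hsa : IsSelfAdjoint (star T * T) := IsSelfAdjoint.star_mul_self T
  -- By the C*-identity the squared norm is that of `t g(t)²` evaluated at `T* T`.
  have h1 : star (T * cfc g (star T * T)) * (T * cfc g (star T * T))
      = cfc (fun t => g t * (t * g t)) (star T * T) := by
    rw [cfc_mul g (fun t => t * g t) (star T * T) hg.continuousOn (by fun_prop),
      cfc_mul (fun t => t) g (star T * T) (by fun_prop) hg.continuousOn,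
      cfc_id' ℝ (star T * T), star_mul, (cfc_predicate g (star T * T)).star_eq]
    simp only [mul_assoc]
  refine abs_le_of_sq_le_sq' ?_ hb |>.2
  rw [sq, ← CStarRing.norm_star_mul_self, h1]
  refine norm_cfc_le (by positivity) fun t ht => ?_
  have ht0 := spectrum_star_mul_self_nonneg t ht
  have h2 := h t ht0
  have : g t * (t * g t) = (√t * |g t|) ^ 2 := by
    rw [mul_pow, Real.sq_sqrt ht0, sq_abs]; ring
  rw [this, Real.norm_of_nonneg (sq_nonneg _)]
  exact pow_le_pow_left₀ (by positivity) h2 2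

/-- `T (|T| + δ)⁻¹` is a regularized polar factor, and the range of a continuous cutoff of `T* T`
stands in for a spectral subspace of `|T|` above `c`. If that range had dimension at most `n`, then
`T` times the cutoff would approximate `T` better than `singVal T n` permits. -/
theorem exists_submodule_of_lt_singVal (T : H →L[ℂ] H) {n : ℕ} {c δ : ℝ} (hc : 0 ≤ c)
    (hcs : c < singVal T n) (hδ : 0 < δ) :
    ∃ M : Submodule ℂ H, (n : Cardinal) < Module.rank ℂ M ∧ ∀ x ∈ M,
      (c - δ) * ‖x‖ ^ 2
        ≤ (inner ℂ ((T * cfc (fun t => (√t + δ)⁻¹) (star T * T)) x) (T x)).re := by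
  have hsa : IsSelfAdjoint (star T * T) := IsSelfAdjoint.star_mul_self T
  obtain ⟨b, hcb, hbs⟩ := exists_between hcs
  let g : ℝ → ℝ := fun t => min 1 (max 0 ((√t - c) / (b - c)))
  have hg : Continuous g := by fun_prop
  have hg0 : ∀ t, √t ≤ c → g t = 0 := fun t ht => by
    have : (√t - c) / (b - c) ≤ 0 := div_nonpos_of_nonpos_of_nonneg (by linarith) (by linarith)
    simp [g, max_eq_left this]
  have hg1 : ∀ t, b ≤ √t → g t = 1 := fun t ht => by
    have : 1 ≤ (√t - c) / (b - c) := by rw [one_le_div (by linarith)]; linarith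
    simp [g, this]
  have hg01 : ∀ t, 0 ≤ g t ∧ g t ≤ 1 := fun t =>
    ⟨le_min zero_le_one (le_max_left _ _), min_le_left _ _⟩
  let h : ℝ → ℝ := fun t => (√t + δ)⁻¹
  have hpos : ∀ t : ℝ, √t + δ ≠ 0 := fun t => by positivity
  have hh : Continuous h := by
    have : Continuous fun t : ℝ => √t + δ := by fun_prop
    exact this.inv₀ hpos
  refine ⟨LinearMap.range ((cfc g (star T * T) : H →L[ℂ] H) : H →ₗ[ℂ] H), ?_, ?_⟩
  · by_contra! hrank
    have h1 : singVal T n ≤ ‖T - T * cfc g (star T * T)‖ := singVal_le_norm_sub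
      ((LinearMap.rank_comp_le_right ((cfc g (star T * T) : H →L[ℂ] H) : H →ₗ[ℂ] H) (T : H →ₗ[ℂ] H)).trans hrank)
    have h2 : T - T * cfc g (star T * T) = T * cfc (fun t => 1 - g t) (star T * T) := by
      rw [cfc_sub (fun _ => 1) g (star T * T) (by fun_prop) hg.continuousOn,
        cfc_const_one ℝ (star T * T), mul_sub, mul_one]
    have h3 : ‖T - T * cfc g (star T * T)‖ ≤ b := by
      rw [h2]
      refine norm_mul_cfc_star_mul_self_le T (by fun_prop) (hc.trans hcb.le) fun t ht => ?_
      rcases le_total b (√t) with hb | hb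
      · simp [hg1 t hb, hc.trans hcb.le]
      · rw [abs_of_nonneg (by linarith [(hg01 t).2])]
        exact (mul_le_of_le_one_right (Real.sqrt_nonneg t) (by linarith [(hg01 t).1])).trans hb
    linarith
  · rintro _ ⟨y, rfl⟩
    set P : H →L[ℂ] H := cfc g (star T * T) with hP
    set K : H →L[ℂ] H := cfc h (star T * T) with hK
    have hPs : star P = P := (cfc_predicate g (star T * T)).star_eq
    have hKs : star K = K := (cfc_predicate h (star T * T)).star_eq
    have hPp : ContinuousLinearMap.adjoint P = P := hPs
    have hKp : ContinuousLinearMap.adjoint K = K := hKs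
    have hQ : P * (K * ((star T * T) * P)) - (c - δ) • (P * P)
        = cfc (fun t => g t * (h t * (t * g t)) - (c - δ) • (g t * g t)) (star T * T) := by
      rw [cfc_sub (fun t => g t * (h t * (t * g t))) (fun t => (c - δ) • (g t * g t)) _
          (by fun_prop) (by fun_prop), cfc_smul (c - δ) (fun t => g t * g t) _ (by fun_prop),
        cfc_mul g g _ (by fun_prop) (by fun_prop),
        cfc_mul g (fun t => h t * (t * g t)) _ (by fun_prop) (by fun_prop),
        cfc_mul h (fun t => t * g t) _ (by fun_prop) (by fun_prop),
        cfc_mul (fun t => t) g _ (by fun_prop) (by fun_prop), cfc_id' ℝ (star T * T)]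
    have hQ0 : 0 ≤ P * (K * ((star T * T) * P)) - (c - δ) • (P * P) := by
      rw [hQ]
      refine cfc_nonneg fun t ht => ?_
      have ht0 := spectrum_star_mul_self_nonneg t ht
      rcases le_total (√t) c with hct | hct
      · simp [hg0 t hct]
      -- For `√t ≥ c` this follows from `t ≥ t - δ² = (√t - δ)(√t + δ)`.
      · have h1 : c - δ ≤ h t * t := by
          rw [show h t * t = t / (√t + δ) by simp only [h]; ring, le_div_iff₀ (by positivity)]
          nlinarith [Real.sq_sqrt ht0, Real.sqrt_nonneg t, sq_nonneg δ]
        rw [smul_eq_mul]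
        nlinarith [mul_nonneg (sub_nonneg.2 h1) (mul_self_nonneg (g t))]
    have hre := ((ContinuousLinearMap.nonneg_iff_isPositive _).1 hQ0).re_inner_nonneg_right y
    have e1 : inner ℂ y ((P * (K * ((star T * T) * P))) y) = inner ℂ ((T * K) (P y)) (T (P y)) := by
      change inner ℂ y (P (K (ContinuousLinearMap.adjoint T (T (P y))))) = inner ℂ (T (K (P y))) (T (P y))
      rw [← ContinuousLinearMap.adjoint_inner_left, hPp, ← ContinuousLinearMap.adjoint_inner_left,
        hKp, ContinuousLinearMap.adjoint_inner_right]
    have e2 : inner ℂ y ((P * P) y) = ((‖P y‖ ^ 2 : ℝ) : ℂ) := by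
      change inner ℂ y (P (P y)) = _
      rw [← ContinuousLinearMap.adjoint_inner_left, hPp, inner_self_eq_norm_sq_to_K]
      simp
    have e3 : (((c - δ) • (P * P) : H →L[ℂ] H)) y = ((c - δ : ℝ) : ℂ) • ((P * P) y) := (Complex.coe_smul (c - δ) ((P * P) y)).symm
    rw [sub_apply, inner_sub_right, e1, e3, inner_smul_right, e2] at hre
    simp only [map_sub, RCLike.re_to_complex, ← Complex.ofReal_mul, Complex.ofReal_re] at hre
    change (c - δ) * ‖P y‖ ^ 2 ≤ (inner ℂ ((T * K) (P y)) (T (P y))).re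
    linarith

/-- Moving `W` across the inner product absorbs it into the left factor as `star W`, leaving a
diagonal sum of `star W * X * T * Y`. -/
theorem norm_pairing_mul_mul_le {m : ℕ} {e : Fin m → H} (he : Orthonormal ℂ e) {W : H →L[ℂ] H}
    (hW : ‖W‖ ≤ 1) (X T Y : H →L[ℂ] H) :
    ‖pairing e W (X * T * Y)‖ ≤ ‖X‖ * ‖Y‖ * ∑ i ∈ Finset.range m, singVal T i := by
  have h1 : pairing e W (X * T * Y) = ∑ i, inner ℂ (e i) ((star W * X * T * Y) (e i)) := by
    rw [pairing_apply]
    refine Finset.sum_congr rfl fun i _ => ?_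
    exact (ContinuousLinearMap.adjoint_inner_right W _ _).symm
  rw [h1, Finset.mul_sum]
  refine (norm_sum_inner_le_sum_singVal he _).trans (Finset.sum_le_sum fun i _ => ?_)
  refine (singVal_mul_mul_le _ _ _ _).trans ?_
  gcongr
  · exact singVal_nonneg _ _
  · refine (norm_mul_le _ _).trans ?_
    rw [norm_star]
    exact mul_le_of_le_one_left (norm_nonneg _) hW

/-- A regularized polar factor of `T` as `W` nearly attains the Ky Fan sum. Systems shorter than `k`
are admitted because `H` may have dimension below `k`; the missing singular values then vanish. -/
theorem sum_singVal_le_of_pairing_le {T : H →L[ℂ] H} {k : ℕ} {C : ℝ}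
    (h : ∀ m ≤ k, ∀ (e : Fin m → H) (W : H →L[ℂ] H), Orthonormal ℂ e → ‖W‖ ≤ 1 →
      ‖pairing e W T‖ ≤ C) :
    ∑ i ∈ Finset.range k, singVal T i ≤ C := by
  induction k with
  | zero =>
    simpa using (norm_nonneg _).trans
      (h 0 le_rfl Fin.elim0 0 ⟨fun i => i.elim0, fun i => i.elim0⟩ (by simp))
  | succ k ih =>
    rcases (singVal_nonneg T k).eq_or_lt with h0 | h0
    · rw [Finset.sum_range_succ, ← h0, add_zero]
      exact ih fun m hm => h m (by omega)
    have hpos : ∀ i < k + 1, 0 < singVal T i := fun i hi =>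
      h0.trans_le (singVal_antitone T (by omega))
    refine le_of_forall_pos_le_add fun ε hε => ?_
    -- Each of the `k + 1` terms loses `2δ`: one `δ` from choosing the level below `singVal T i`,
    -- one from the regularization.
    let δ : ℝ := ε / (2 * (k + 1))
    have hδ : 0 < δ := by positivity
    have hex : ∀ i, ∃ M : Submodule ℂ H, i < k + 1 → (i : Cardinal) < Module.rank ℂ M ∧ ∀ x ∈ M,
        (max (singVal T i - δ) 0 - δ) * ‖x‖ ^ 2
          ≤ (inner ℂ ((T * cfc (fun t => (√t + δ)⁻¹) (star T * T)) x) (T x)).re := by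
      intro i
      by_cases hi : i < k + 1
      · obtain ⟨M, hM⟩ := exists_submodule_of_lt_singVal T (n := i)
          (c := max (singVal T i - δ) 0) (le_max_right _ _) (max_lt (by linarith) (hpos i hi)) hδ
        exact ⟨M, fun _ => hM⟩
      · exact ⟨⊥, fun h => absurd h hi⟩
    choose M hM using hex
    obtain ⟨u, hu, huM⟩ := exists_orthonormal_mem M fun i hi => (hM i hi).1
    have hW : ‖T * cfc (fun t => (√t + δ)⁻¹) (star T * T)‖ ≤ 1 := by
      have hcont : Continuous fun t : ℝ => √t + δ := by fun_prop
      refine norm_mul_cfc_star_mul_self_le T (hcont.inv₀ fun t => by positivity) zero_le_one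
        fun t _ => ?_
      change √t * |(√t + δ)⁻¹| ≤ 1
      rw [abs_of_nonneg (by positivity), ← div_eq_mul_inv, div_le_one (by positivity)]
      linarith
    have h1 := h (k + 1) le_rfl u _ hu hW
    rw [pairing_apply] at h1
    have h2 := (Complex.re_le_norm _).trans h1
    rw [Complex.re_sum] at h2
    have h3 : ∑ i : Fin (k + 1), (singVal T i - δ - δ) ≤ C := by
      refine (Finset.sum_le_sum fun i _ => ?_).trans h2
      have h4 := (hM i i.2).2 _ (huM i)
      rw [hu.1 i] at h4
      linarith [le_max_left (singVal T i - δ) 0]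
    rw [Fin.sum_univ_eq_sum_range (fun i => singVal T i - δ - δ), Finset.sum_sub_distrib,
      Finset.sum_sub_distrib] at h3
    have h5 : (k + 1 : ℝ) * (2 * δ) = ε := by simp only [δ]; field_simp
    simp only [Finset.sum_const, Finset.card_range, nsmul_eq_mul, Nat.cast_add, Nat.cast_one] at h3
    linarith

/-- Ky Fan dominance: the bounds on pairings say that the singular values of `T` are weakly
majorized by `c` times those of `M`. -/
theorem uiNorm_le_of_pairing_le (Φ : SymmetricNormingFunction) {T M : H →L[ℂ] H} {c : ℝ}
    (hc : 0 ≤ c)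
    (h : ∀ (m : ℕ) (e : Fin m → H) (W : H →L[ℂ] H), Orthonormal ℂ e → ‖W‖ ≤ 1 →
      ‖pairing e W T‖ ≤ c * ∑ i ∈ Finset.range m, singVal M i) :
    uiNorm Φ T ≤ ENNReal.ofReal c * uiNorm Φ M := by
  refine iSup_le fun n => ?_
  have h1 : Φ.toFun (truncSingVal T n) ≤ c * Φ.toFun (truncSingVal M n) := by
    have h2 : c * Φ.toFun (truncSingVal M n)
        = Φ.toFun (∑ i ∈ Finset.range n, Finsupp.single i (c * singVal M i)) := by
      have := Φ.smul c (truncSingVal M n)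
      rw [abs_of_nonneg hc] at this
      rw [← this, truncSingVal, Finset.smul_sum]
      simp
    rw [h2]
    refine Φ.le_of_sum_range_le (singVal_antitone T) (singVal_nonneg T) fun k _ => ?_
    rw [← Finset.mul_sum]
    refine sum_singVal_le_of_pairing_le fun m hm e W he hW => (h m e W he hW).trans ?_
    exact mul_le_mul_of_nonneg_left (Finset.sum_le_sum_of_subset_of_nonneg
      (Finset.range_subset_range.2 hm) fun i _ _ => singVal_nonneg M i) hc
  calc _ ≤ ENNReal.ofReal (c * Φ.toFun (truncSingVal M n)) := ENNReal.ofReal_le_ofReal h1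
    _ = ENNReal.ofReal c * ENNReal.ofReal (Φ.toFun (truncSingVal M n)) := ENNReal.ofReal_mul hc
    _ ≤ _ := by
      gcongr
      exact le_iSup (fun n => ENNReal.ofReal (Φ.toFun (truncSingVal M n))) n

end SingValLower

/-! ### Circle averages and the Herglotz formula. -/

section CircleAverage

open Metric Real

theorem norm_circleAverage_le {E : Type*} [NormedAddCommGroup E] [NormedSpace ℝ E] {F : ℂ → E}
    {G : ℂ → ℝ} {r : ℝ} (hr : 0 ≤ r) (hG : CircleIntegrable G 0 r)
    (h : ∀ z ∈ sphere (0 : ℂ) r, ‖F z‖ ≤ G z) :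
    ‖circleAverage F 0 r‖ ≤ circleAverage G 0 r := by
  rw [circleAverage, circleAverage, norm_smul, Real.norm_of_nonneg (by positivity), smul_eq_mul]
  gcongr
  refine intervalIntegral.norm_integral_le_of_norm_le (by positivity)
    (Filter.Eventually.of_forall fun θ _ => h _ (circleMap_mem_sphere 0 hr θ)) hG

/-- The Herglotz formula on the unit circle. -/
theorem circleAverage_re_mul_herglotz {g : ℂ → ℂ} (hg : DiffContOnCl ℂ g (ball 0 1))
    (hg0 : g 0 = 1) {w : ℂ} (hw : w ∈ ball (0 : ℂ) 1) :
    circleAverage (fun z => ((g z).re : ℂ) * ((z + w) * (z - w)⁻¹)) 0 1 = g w := by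
  have hw1 : ‖w‖ < 1 := by simpa using hw
  have hgc : ContinuousOn g (sphere 0 1) :=
    hg.continuousOn.mono (by rw [closure_ball _ one_ne_zero]; exact sphere_subset_closedBall)
  have hne : ∀ z ∈ closedBall (0 : ℂ) 1, 1 - (starRingEnd ℂ) w * z ≠ 0 := by
    intro z hz h
    have h1 : (starRingEnd ℂ) w * z = 1 := (sub_eq_zero.1 h).symm
    have h2 : ‖w‖ * ‖z‖ = 1 := by rw [← Complex.norm_conj w, ← norm_mul, h1, norm_one]
    have h3 : ‖z‖ ≤ 1 := by simpa using hz
    nlinarith [norm_nonneg w, norm_nonneg z]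
  have hzw : ∀ z ∈ sphere (0 : ℂ) 1, z - w ≠ 0 := by
    intro z hz h
    have h1 : ‖z‖ = 1 := by simpa using hz
    rw [sub_eq_zero.1 h] at h1
    linarith
  -- On the circle `conj z = z⁻¹`, so `conj (k z)` is `conj (g z)` times the Herglotz kernel, while
  -- `k` itself is analytic with `k 0 = 1`.
  let k : ℂ → ℂ := fun z => g z * ((1 + (starRingEnd ℂ) w * z) * (1 - (starRingEnd ℂ) w * z)⁻¹)
  have hk : DiffContOnCl ℂ k (ball 0 1) := by
    refine DiffContOnCl.smul hg (DifferentiableOn.diffContOnCl ?_)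
    rw [closure_ball _ one_ne_zero]
    exact DifferentiableOn.mul (by fun_prop) (DifferentiableOn.inv (by fun_prop) hne)
  have hkc : ContinuousOn k (sphere 0 1) :=
    hk.continuousOn.mono (by rw [closure_ball _ one_ne_zero]; exact sphere_subset_closedBall)
  have hcauchy : ContinuousOn (fun z => ((z - 0) / (z - w)) • g z) (sphere 0 1) :=
    ContinuousOn.smul (ContinuousOn.div (by fun_prop) (by fun_prop) hzw) hgc
  have a1 : circleAverage (fun z => ((z - 0) / (z - w)) • g z) 0 1 = g w := by
    refine DiffContOnCl.circleAverage_smul_div ?_ ?_ <;> simpa using ‹_›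
  have a2 : circleAverage g 0 1 = 1 := by
    rw [← hg0]
    exact DiffContOnCl.circleAverage (by simpa using hg)
  have a3 : circleAverage k 0 1 = 1 := by
    rw [DiffContOnCl.circleAverage (by simpa using hk)]
    simp [k, hg0]
  have i1 : CircleIntegrable (fun z => ((z - 0) / (z - w)) • g z) 0 1 :=
    hcauchy.circleIntegrable zero_le_one
  have i2 : CircleIntegrable g 0 1 := hgc.circleIntegrable zero_le_one
  have i3 : CircleIntegrable k 0 1 := hkc.circleIntegrable zero_le_one
  have i4 : CircleIntegrable (fun z => (starRingEnd ℂ) (k z)) 0 1 :=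
    (Complex.continuous_conj.comp_continuousOn hkc).circleIntegrable zero_le_one
  have a4 : circleAverage (fun z => (starRingEnd ℂ) (k z)) 0 1 = 1 := by
    have := (Complex.conjCLE : ℂ →L[ℝ] ℂ).circleAverage_comp_comm i3
    rw [a3] at this
    simpa [Function.comp_def] using this
  -- Use `Re g = (g + conj g)/2` and `(z+w)/(z-w) = 2z/(z-w) - 1`: Cauchy's formula gives `g w`, and
  -- the remaining means cancel.
  calc circleAverage (fun z => ((g z).re : ℂ) * ((z + w) * (z - w)⁻¹)) 0 1
      = circleAverage (fun z => ((z - 0) / (z - w)) • g z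
          + (1 / 2 : ℂ) • ((starRingEnd ℂ) (k z) - g z)) 0 1 := by
        refine circleAverage_congr_sphere fun z hz => ?_
        rw [abs_one] at hz
        have hz1 : z * (starRingEnd ℂ) z = 1 := by
          rw [Complex.mul_conj, Complex.normSq_eq_norm_sq]
          simp [show ‖z‖ = 1 by simpa using hz]
        have hz0 : z ≠ 0 := left_ne_zero_of_mul_eq_one hz1
        have hconj : (starRingEnd ℂ) z = z⁻¹ := eq_inv_of_mul_eq_one_right hz1
        have h1 := hzw z hz
        have h2 : (starRingEnd ℂ) (k z)
            = (starRingEnd ℂ) (g z) * ((z + w) * (z - w)⁻¹) := by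
          have h3 : 1 - w * z⁻¹ = (z - w) * z⁻¹ := by field_simp
          simp only [k, map_mul, map_add, map_sub, map_one, map_inv₀, Complex.conj_conj, hconj]
          rw [h3]
          field_simp
        simp only [h2, Complex.re_eq_add_conj, smul_eq_mul]
        field_simp
        ring
    _ = g w := by
        rw [circleAverage_fun_add i1 (by exact (i4.sub i2).const_smul), a1, circleAverage_fun_smul,
          circleAverage_fun_sub i4 i2, a4, a2]
        simp

end CircleAverage

theorem distCircle_le {H : Type*} [NormedAddCommGroup H] [InnerProductSpace ℂ H]
    {T : H →L[ℂ] H} {z w : ℂ} (hz : z ∈ Metric.sphere (0 : ℂ) 1) (hw : w ∈ spectrum ℂ T) : distCircle T ≤ ‖z - w‖ :=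
  csInf_le ⟨0, by rintro _ ⟨z, -, w, -, rfl⟩; exact dist_nonneg⟩ ⟨z, hz, w, hw, dist_eq_norm z w⟩

/-! ### Continuous functional calculus and contour integrals. -/

section NormalCalculus

open Metric Real Filter Topology

variable {H : Type*} [NormedAddCommGroup H] [InnerProductSpace ℂ H] [CompleteSpace H]

/-- The kernel is bounded on the compact set circle × spectrum, so the calculus may be interchanged
with the integral. -/
theorem circleIntegrable_cfc_and_cfc_circleAverage {A : H →L[ℂ] H} (hA : IsStarNormal A)
    {K : ℂ → ℂ → ℂ} {r : ℝ} (hr : 0 ≤ r)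
    (hK : ContinuousOn (Function.uncurry K) (sphere 0 r ×ˢ spectrum ℂ A)) :
    CircleIntegrable (fun z => cfc (K z) A) 0 r ∧
      cfc (fun w => circleAverage (fun z => K z w) 0 r) A
        = circleAverage (fun z => cfc (K z) A) 0 r := by
  obtain ⟨b, hb⟩ := ((isCompact_sphere (0 : ℂ) r).prod
    (spectrum.isCompact A)).exists_bound_of_continuousOn hK
  have hcont : ∀ c : ℝ, ContinuousOn (Function.uncurry fun θ w => c • K (circleMap 0 r θ) w)
      (Set.univ ×ˢ spectrum ℂ A) := fun c => by
    refine ContinuousOn.const_smul (hK.comp (f := fun p : ℝ × ℂ => (circleMap 0 r p.1, p.2))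
      (by fun_prop) ?_) c
    exact fun p hp => ⟨circleMap_mem_sphere 0 hr p.1, hp.2⟩
  have hbound : ∀ c θ : ℝ, ∀ w ∈ spectrum ℂ A, ‖c • K (circleMap 0 r θ) w‖ ≤ |c| * b := by
    intro c θ w hw
    rw [norm_smul, Real.norm_eq_abs]
    exact mul_le_mul_of_nonneg_left (hb (_, w) ⟨circleMap_mem_sphere 0 hr θ, hw⟩) (abs_nonneg c)
  constructor
  · rw [CircleIntegrable, intervalIntegrable_iff_integrableOn_Ioc_of_le (by positivity)]
    have := integrable_cfc (μ := MeasureTheory.volume.restrict (Set.Ioc 0 (2 * π)))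
      (fun θ w => (1 : ℝ) • K (circleMap 0 r θ) w) (fun _ => |1| * b) A (hcont 1)
      (Eventually.of_forall fun θ => hbound 1 θ) (MeasureTheory.hasFiniteIntegral_const _)
    simp only [one_smul] at this
    exact this
  · have h1 := cfc_integral (μ := MeasureTheory.volume.restrict (Set.Ioc 0 (2 * π)))
      (fun θ w => (2 * π)⁻¹ • K (circleMap 0 r θ) w) (fun _ => |(2 * π)⁻¹| * b) A (hcont _)
      (Eventually.of_forall fun θ => hbound _ θ) (MeasureTheory.hasFiniteIntegral_const _)
    have h2 : ∀ θ, cfc (fun w => (2 * π)⁻¹ • K (circleMap 0 r θ) w) A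
        = (2 * π)⁻¹ • cfc (K (circleMap 0 r θ)) A := fun θ =>
      cfc_smul _ _ A (hK.comp (f := fun w => (circleMap 0 r θ, w)) (by fun_prop)
        fun w hw => ⟨circleMap_mem_sphere 0 hr θ, hw⟩)
    simp only [h2, MeasureTheory.integral_smul] at h1
    simpa only [circleAverage, intervalIntegral.integral_of_le (show 0 ≤ 2 * π by positivity)]
      using h1

theorem resolvent_eq_cfc {A : H →L[ℂ] H} (hA : IsStarNormal A) {z : ℂ}
    (hz : ∀ w ∈ spectrum ℂ A, z - w ≠ 0) : resolvent A z = cfc (fun w => (z - w)⁻¹) A := by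
  rw [cfc_inv (fun w => z - w) A hz (by fun_prop), cfc_sub (fun _ => z) (fun w => w) A,
    cfc_const z A, cfc_id' ℂ A]
  rfl

theorem continuousOn_sub_inv {s : Set ℂ} {r : ℝ} (hs : s ⊆ ball 0 r) :
    ContinuousOn (fun p : ℂ × ℂ => (p.1 - p.2)⁻¹) (sphere 0 r ×ˢ s) := by
  refine ContinuousOn.inv₀ (by fun_prop) ?_
  rintro ⟨z, w⟩ ⟨hz, hw⟩ h
  have h1 := hs hw
  rw [← sub_eq_zero.1 h] at h1
  exact (sphere_disjoint_ball.ne_of_mem hz h1) rfl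

theorem sub_ne_zero_of_mem_sphere {s : Set ℂ} {r : ℝ} (hs : s ⊆ ball 0 r) {z : ℂ}
    (hz : z ∈ sphere (0 : ℂ) r) : ∀ w ∈ s, z - w ≠ 0 :=
  fun _ hw h => (sphere_disjoint_ball.ne_of_mem hz (hs hw)) (sub_eq_zero.1 h)

theorem analyticCalc_eq_cfc {A : H →L[ℂ] H} (hA : IsStarNormal A)
    (hσ : spectrum ℂ A ⊆ ball 0 1) {f : ℂ → ℂ} (hf : AnalyticOnNhd ℂ f (ball 0 1)) :
    analyticCalc f A = cfc f A := by
  obtain ⟨r, ⟨hr0, hr1⟩, hr⟩ := exists_pos_lt_subset_ball one_pos (spectrum.isClosed A) hσ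
  have hfr : DifferentiableOn ℂ f (closedBall 0 r) :=
    hf.differentiableOn.mono (closedBall_subset_ball hr1)
  have hfc : ContinuousOn f (sphere 0 r) := hfr.continuousOn.mono sphere_subset_closedBall
  -- The factor `z` cancels the `1/z` that a circle average carries as a contour integral.
  let K : ℂ → ℂ → ℂ := fun z w => (z * f z) • (z - w)⁻¹
  have hK : ContinuousOn (Function.uncurry K) (sphere 0 r ×ˢ spectrum ℂ A) :=
    ContinuousOn.smul (continuousOn_fst.mul (hfc.comp continuousOn_fst fun p hp => hp.1))
      (continuousOn_sub_inv hr)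
  rw [← rieszDunford_eq_analyticCalc hf hr0 hr1 hr, rieszDunford]
  have h1 : (2 * π * Complex.I : ℂ)⁻¹ • ∮ z in C(0, r), f z • resolvent A z
      = circleAverage (fun z => cfc (K z) A) 0 r := by
    rw [circleAverage_eq_circleIntegral hr0.ne']
    congr 1
    refine circleIntegral.integral_congr hr0.le fun z hz => ?_
    have hz0 : z ≠ 0 := ne_of_mem_sphere hz hr0.ne'
    have h2 := sub_ne_zero_of_mem_sphere hr hz
    dsimp only [K]
    rw [cfc_smul (z * f z) (fun w => (z - w)⁻¹) A (ContinuousOn.inv₀ (by fun_prop) h2),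
      resolvent_eq_cfc hA h2, smul_smul, sub_zero, inv_mul_cancel_left₀ hz0]
  rw [h1, ← (circleIntegrable_cfc_and_cfc_circleAverage hA hr0.le hK).2]
  refine cfc_congr fun w hw => ?_
  have h3 : DiffContOnCl ℂ f (ball 0 |r|) := by
    rw [abs_of_pos hr0]
    exact DifferentiableOn.diffContOnCl (by rwa [closure_ball _ hr0.ne'])
  rw [← h3.circleAverage_smul_div (by rw [abs_of_pos hr0]; exact hr hw)]
  refine circleAverage_congr_sphere fun z _ => ?_
  simp only [K, smul_eq_mul, sub_zero]
  ring

/-- Compactness keeps the spectrum in a smaller disk. Nontriviality makes the spectrum nonempty; on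
the zero space the infimum of the empty set is `0`. -/
theorem distCircle_pos [Nontrivial H] {T : H →L[ℂ] H} (hσ : spectrum ℂ T ⊆ ball 0 1) :
    0 < distCircle T := by
  obtain ⟨r, ⟨-, hr1⟩, hr⟩ := exists_pos_lt_subset_ball one_pos (spectrum.isClosed T) hσ
  obtain ⟨w, hw⟩ := spectrum.nonempty T
  refine (sub_pos.2 hr1).trans_le (le_csInf ⟨_, 1, by simp, w, hw, rfl⟩ ?_)
  rintro _ ⟨z, hz, w, hw, rfl⟩
  have h1 : ‖w‖ < r := by simpa using hr hw
  have h2 : ‖z‖ = 1 := by simpa using hz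
  rw [dist_eq_norm]
  linarith [norm_sub_norm_le z w]

theorem norm_resolvent_le [Nontrivial H] {A : H →L[ℂ] H}
    (hσ : spectrum ℂ A ⊆ ball 0 1) {z : ℂ} (hz : z ∈ sphere (0 : ℂ) 1) :
    ‖cfc (fun w => (z - w)⁻¹) A‖ ≤ (distCircle A)⁻¹ := by
  have hpos := distCircle_pos hσ
  refine norm_cfc_le (by positivity) fun w hw => ?_
  rw [norm_inv]
  exact inv_anti₀ hpos (distCircle_le hz hw)

end NormalCalculus

/-! ### The operator Herglotz identity and the main estimate. -/

section MainEstimate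

open Metric Real Filter Topology

/-- Inserting `(z' - b) s = 1` and `r (z - a) = 1` puts both terms between `r` and `s`. The mixed
terms cancel because scalars are central, so `a` and `b` need not commute. -/
theorem herglotz_add_eq {R : Type*} [Ring R] [Algebra ℂ R] {z z' : ℂ} (hz : z * z' = 1)
    {a b r s : R} (hr : r * (algebraMap ℂ R z - a) = 1) (hs : (algebraMap ℂ R z' - b) * s = 1) :
    r * (algebraMap ℂ R z + a) + (algebraMap ℂ R z' + b) * s = (2 : ℂ) • (r * (1 - a * b) * s) := by
  have h1 : algebraMap ℂ R z * algebraMap ℂ R z' = 1 := by rw [← map_mul, hz, map_one]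
  have h2 : a * algebraMap ℂ R z' = algebraMap ℂ R z' * a := (Algebra.commutes z' a).symm
  have h3 : algebraMap ℂ R z * b = b * algebraMap ℂ R z := Algebra.commutes z b
  calc _ = r * (algebraMap ℂ R z + a) * ((algebraMap ℂ R z' - b) * s)
        + r * (algebraMap ℂ R z - a) * ((algebraMap ℂ R z' + b) * s) := by
        rw [hr, hs, mul_one, one_mul]
    _ = r * ((algebraMap ℂ R z + a) * (algebraMap ℂ R z' - b)
        + (algebraMap ℂ R z - a) * (algebraMap ℂ R z' + b)) * s := by noncomm_ring
    _ = r * ((2 : ℂ) • (1 - a * b)) * s := by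
        congr 2
        rw [two_smul, ← h1]
        noncomm_ring
    _ = _ := by rw [mul_smul_comm, smul_mul_assoc]

variable {H : Type*} [NormedAddCommGroup H] [InnerProductSpace ℂ H] [CompleteSpace H]

theorem cfc_herglotz {A : H →L[ℂ] H} (hA : IsStarNormal A) {z : ℂ}
    (hz : ∀ w ∈ spectrum ℂ A, z - w ≠ 0) :
    cfc (fun w => (z - w)⁻¹) A * (algebraMap ℂ (H →L[ℂ] H) z - A) = 1 ∧
    cfc (fun w => (z + w) * (z - w)⁻¹) A
      = cfc (fun w => (z - w)⁻¹) A * (algebraMap ℂ (H →L[ℂ] H) z + A) := by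
  have hc : ContinuousOn (fun w => (z - w)⁻¹) (spectrum ℂ A) := ContinuousOn.inv₀ (by fun_prop) hz
  have h1 : algebraMap ℂ (H →L[ℂ] H) z - A = cfc (fun w => z - w) A := by
    rw [cfc_sub (fun _ => z) (fun w => w) A, cfc_const z A, cfc_id' ℂ A]
  have h2 : algebraMap ℂ (H →L[ℂ] H) z + A = cfc (fun w => z + w) A := by
    rw [cfc_add A (fun _ => z) (fun w => w), cfc_const z A, cfc_id' ℂ A]
  rw [h1, h2, ← cfc_mul (fun w => (z - w)⁻¹) (fun w => z - w) A hc (by fun_prop),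
    ← cfc_mul (fun w => (z - w)⁻¹) (fun w => z + w) A hc (by fun_prop)]
  refine ⟨?_, cfc_congr fun w _ => mul_comm _ _⟩
  rw [← cfc_const_one ℂ A]
  exact cfc_congr fun w hw => inv_mul_cancel₀ (hz w hw)

/-- The two Herglotz transforms of a pair of normal operators. -/
theorem cfc_herglotz_add_star {A B : H →L[ℂ] H} (hA : IsStarNormal A) (hB : IsStarNormal B)
    (hσA : spectrum ℂ A ⊆ ball 0 1) (hσB : spectrum ℂ B ⊆ ball 0 1) {z : ℂ}
    (hz : z ∈ sphere (0 : ℂ) 1) :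
    cfc (fun w => (z + w) * (z - w)⁻¹) A + star (cfc (fun w => (z + w) * (z - w)⁻¹) B)
      = (2 : ℂ) • (cfc (fun w => (z - w)⁻¹) A * (1 - A * star B)
        * star (cfc (fun w => (z - w)⁻¹) B)) := by
  obtain ⟨a1, a2⟩ := cfc_herglotz hA (sub_ne_zero_of_mem_sphere hσA hz)
  obtain ⟨b1, b2⟩ := cfc_herglotz hB (sub_ne_zero_of_mem_sphere hσB hz)
  have hs : ∀ x y : H →L[ℂ] H, star (x * y) = star y * star x := star_mul
  have hz1 : z * star z = 1 := by
    change z * (starRingEnd ℂ) z = 1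
    rw [Complex.mul_conj, Complex.normSq_eq_norm_sq]
    simp [show ‖z‖ = 1 by simpa using hz]
  have b3 := congrArg star b1
  rw [hs, star_sub, ← algebraMap_star_comm, star_one] at b3
  rw [a2, b2, hs, star_add, ← algebraMap_star_comm]
  exact herglotz_add_eq hz1 a1 b3

/-- The pairing is the mean of its values on the integrand, each at most `Re g(z)` times the claimed
bound. -/
theorem norm_pairing_cfc_add_star_le [Nontrivial H] {A B : H →L[ℂ] H} (hA : IsStarNormal A)
    (hB : IsStarNormal B) (hσA : spectrum ℂ A ⊆ ball 0 1) (hσB : spectrum ℂ B ⊆ ball 0 1)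
    {g : ℂ → ℂ} (hg : DiffContOnCl ℂ g (ball 0 1)) (hg0 : g 0 = 1)
    (hre : ∀ z ∈ sphere (0 : ℂ) 1, 0 ≤ (g z).re) {m : ℕ} {e : Fin m → H} (he : Orthonormal ℂ e)
    {W : H →L[ℂ] H} (hW : ‖W‖ ≤ 1) :
    ‖pairing e W (cfc g A + star (cfc g B))‖ ≤ 2 / (distCircle A * distCircle B)
      * ∑ i ∈ Finset.range m, singVal (1 - A * star B) i := by
  set C : ℝ := 2 / (distCircle A * distCircle B)
      * ∑ i ∈ Finset.range m, singVal (1 - A * star B) i with hC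
  have hgc : ContinuousOn g (sphere 0 1) :=
    hg.continuousOn.mono (by rw [closure_ball _ one_ne_zero]; exact sphere_subset_closedBall)
  let K : ℂ → ℂ → ℂ := fun z w => ((g z).re : ℂ) • ((z + w) * (z - w)⁻¹)
  have hK : ∀ s ⊆ ball (0 : ℂ) 1, ContinuousOn (Function.uncurry K) (sphere 0 1 ×ˢ s) :=
    fun s hs => ContinuousOn.smul
      (Complex.continuous_ofReal.comp_continuousOn (Complex.continuous_re.comp_continuousOn
        (hgc.comp continuousOn_fst fun p hp => hp.1)))
      (ContinuousOn.mul (by fun_prop) (continuousOn_sub_inv hs))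
  have hcfc : ∀ {T : H →L[ℂ] H}, IsStarNormal T → spectrum ℂ T ⊆ ball 0 1 →
      CircleIntegrable (fun z => cfc (K z) T) 0 1 ∧
        cfc g T = circleAverage (fun z => cfc (K z) T) 0 1 := by
    intro T hT hσ
    obtain ⟨h1, h2⟩ := circleIntegrable_cfc_and_cfc_circleAverage hT zero_le_one (hK _ hσ)
    refine ⟨h1, h2 ▸ cfc_congr fun w hw => ?_⟩
    exact (circleAverage_re_mul_herglotz hg hg0 (hσ hw)).symm
  obtain ⟨iA, eA⟩ := hcfc hA hσA
  obtain ⟨iB, eB⟩ := hcfc hB hσB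
  let S : (H →L[ℂ] H) →L[ℝ] (H →L[ℂ] H) := (starL' ℝ : (H →L[ℂ] H) ≃L[ℝ] (H →L[ℂ] H))
  have hS : ∀ T : H →L[ℂ] H, S T = star T := fun T => rfl
  have iB' : CircleIntegrable (fun z => star (cfc (K z) B)) 0 1 := by
    have := (S.integrable_comp iB.1)
    rw [CircleIntegrable, intervalIntegrable_iff_integrableOn_Ioc_of_le (by positivity)]
    exact this
  have eB' : star (cfc g B) = circleAverage (fun z => star (cfc (K z) B)) 0 1 := by
    have := S.circleAverage_comp_comm iB
    rw [← eB] at this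
    exact this.symm
  have esum : pairing e W (cfc g A + star (cfc g B))
      = circleAverage (fun z => pairing e W (cfc (K z) A + star (cfc (K z) B))) 0 1 := by
    rw [eB', eA, ← circleAverage_fun_add iA iB']
    exact (((pairing e W).restrictScalars ℝ).circleAverage_comp_comm (iA.add iB')).symm
  have ire : CircleIntegrable (fun z => (g z).re * C) 0 1 :=
    ((Complex.continuous_re.comp_continuousOn hgc).mul continuousOn_const).circleIntegrable
      zero_le_one
  -- Mean value property: `Re g` averages to `Re g(0) = 1`.
  have havg : circleAverage (fun z => (g z).re * C) 0 1 = C := by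
    let L : ℂ →L[ℝ] ℝ := C • Complex.reCLM
    have h1 := L.circleAverage_comp_comm (hgc.circleIntegrable zero_le_one)
    rw [DiffContOnCl.circleAverage (by simpa using hg), hg0] at h1
    have h2 : (L ∘ g) = fun z => (g z).re * C := by
      ext z
      simp [L, mul_comm]
    rw [h2] at h1
    simpa [L] using h1
  rw [esum, ← havg]
  refine norm_circleAverage_le zero_le_one ire fun z hz => ?_
  have hne : ∀ {T : H →L[ℂ] H}, spectrum ℂ T ⊆ ball 0 1 →
      cfc (K z) T = ((g z).re : ℂ) • cfc (fun w => (z + w) * (z - w)⁻¹) T := fun hσ =>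
    cfc_smul ((g z).re : ℂ) (fun w => (z + w) * (z - w)⁻¹) _
      (ContinuousOn.mul (by fun_prop)
        (ContinuousOn.inv₀ (by fun_prop) (sub_ne_zero_of_mem_sphere hσ hz)))
  rw [hne hσA, hne hσB, star_smul, show star ((g z).re : ℂ) = (g z).re from Complex.conj_ofReal _,
    ← smul_add, cfc_herglotz_add_star hA hB hσA hσB hz, map_smul, map_smul, norm_smul, norm_smul,
    Complex.norm_real, Real.norm_of_nonneg (hre z hz), Complex.norm_ofNat]
  refine mul_le_mul_of_nonneg_left ?_ (hre z hz)
  have h0 : 0 ≤ ∑ i ∈ Finset.range m, singVal (1 - A * star B) i :=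
    Finset.sum_nonneg fun i _ => singVal_nonneg _ i
  have hA0 := distCircle_pos hσA
  have hB0 := distCircle_pos hσB
  calc _ ≤ 2 * (‖cfc (fun w => (z - w)⁻¹) A‖ * ‖star (cfc (fun w => (z - w)⁻¹) B)‖
        * ∑ i ∈ Finset.range m, singVal (1 - A * star B) i) := by
        gcongr
        exact norm_pairing_mul_mul_le he hW _ _ _
    _ ≤ 2 * ((distCircle A)⁻¹ * (distCircle B)⁻¹
        * ∑ i ∈ Finset.range m, singVal (1 - A * star B) i) := by
        rw [norm_star]
        gcongr
        · exact norm_resolvent_le hσA hz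
        · exact norm_resolvent_le hσB hz
    _ = C := by rw [hC]; field_simp

/-- Joint continuity on the compact set `[0,1] × σ(A)` makes `f(t·)` converge uniformly on the
spectrum. -/
theorem tendsto_cfc_dilation {A : H →L[ℂ] H} (hσ : spectrum ℂ A ⊆ ball 0 1) {f : ℂ → ℂ} (hf : AnalyticOnNhd ℂ f (ball 0 1)) :
    Tendsto (fun t : ℝ => cfc (fun w => f (t * w)) A) (𝓝[Set.Ico 0 1] 1) (𝓝 (cfc f A)) := by
  have hcont : ContinuousOn (Function.uncurry fun (t : ℝ) (w : ℂ) => f (t * w))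
      (Set.Icc 0 1 ×ˢ spectrum ℂ A) := by
    refine hf.continuousOn.comp (f := fun p : ℝ × ℂ => (p.1 : ℂ) * p.2) (by fun_prop) ?_
    rintro ⟨t, w⟩ ⟨ht, hw⟩
    have h1 : ‖w‖ < 1 := by simpa using hσ hw
    rw [mem_ball_zero_iff, norm_mul, Complex.norm_real, Real.norm_of_nonneg ht.1]
    exact (mul_le_of_le_one_left (norm_nonneg w) ht.2).trans_lt h1
  have hunif := UniformContinuousOn.tendstoUniformlyOn (x := (1 : ℝ)) (U := Set.Icc 0 1)
    (V := spectrum ℂ A) (F := fun (t : ℝ) (w : ℂ) => f (t * w))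
    (((isCompact_Icc (a := (0 : ℝ)) (b := 1)).prod
      (spectrum.isCompact A)).uniformContinuousOn_of_continuous hcont) (by simp)
  simp only [Complex.ofReal_one, one_mul] at hunif
  refine Tendsto.mono_left ?_ (nhdsWithin_mono _ Set.Ico_subset_Icc_self)
  refine tendsto_cfc_fun hunif ?_
  filter_upwards [self_mem_nhdsWithin] with t ht
  exact hcont.comp (f := fun w => (t, w)) (by fun_prop) fun w hw => ⟨ht, hw⟩

/-- `f` need not extend to the circle, but `f(t·)` does for `t < 1`; the bound is independent of `t`
and survives the limit. -/
theorem norm_pairing_add_star_le_of_mem_classA [Nontrivial H] {A B : H →L[ℂ] H}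
    (hA : IsStarNormal A) (hB : IsStarNormal B) (hσA : spectrum ℂ A ⊆ ball 0 1)
    (hσB : spectrum ℂ B ⊆ ball 0 1) {f : ℂ → ℂ} (hf : f ∈ classA) {m : ℕ} {e : Fin m → H}
    (he : Orthonormal ℂ e) {W : H →L[ℂ] H} (hW : ‖W‖ ≤ 1) :
    ‖pairing e W (cfc f A + star (cfc f B))‖ ≤ 2 / (distCircle A * distCircle B)
      * ∑ i ∈ Finset.range m, singVal (1 - A * star B) i := by
  obtain ⟨hfa, hfre, hf0⟩ := hf
  have hlim := (((pairing e W).continuous.tendsto _).comp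
    ((tendsto_cfc_dilation hσA hfa).add (tendsto_cfc_dilation hσB hfa).star)).norm
  have : (𝓝[Set.Ico (0 : ℝ) 1] 1).NeBot := by
    rw [← mem_closure_iff_nhdsWithin_neBot, closure_Ico (by norm_num)]
    simp
  refine le_of_tendsto hlim ?_
  filter_upwards [self_mem_nhdsWithin] with t ht
  have hmaps : ∀ z ∈ closedBall (0 : ℂ) 1, (t : ℂ) * z ∈ ball (0 : ℂ) 1 := by
    intro z hz
    have h1 : ‖z‖ ≤ 1 := by simpa using hz
    rw [mem_ball_zero_iff, norm_mul, Complex.norm_real, Real.norm_of_nonneg ht.1]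
    exact (mul_le_of_le_one_right ht.1 h1).trans_lt ht.2
  refine norm_pairing_cfc_add_star_le hA hB hσA hσB (DifferentiableOn.diffContOnCl ?_)
    (by simpa using hf0) (fun z hz => (hfre _ (hmaps z (sphere_subset_closedBall hz))).le) he hW
  rw [closure_ball _ one_ne_zero]
  exact hfa.differentiableOn.comp (by fun_prop) hmaps

theorem uiNorm_zero (Φ : SymmetricNormingFunction) : uiNorm Φ (0 : H →L[ℂ] H) = 0 := by
  have := uiNorm_le_of_pairing_le Φ (T := (0 : H →L[ℂ] H)) (M := 0) le_rfl
    fun m e W _ _ => by simp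
  simpa using this

end MainEstimate

theorem mainTheorem6 {H : Type*} [NormedAddCommGroup H] [InnerProductSpace ℂ H] [CompleteSpace H]
    [TopologicalSpace.SeparableSpace H] (Φ : SymmetricNormingFunction) (A B : H →L[ℂ] H)
    (hA : IsStarNormal A) (hB : IsStarNormal B)
    (hσ : spectrum ℂ A ∪ spectrum ℂ B ⊆ Metric.ball 0 1) (f : ℂ → ℂ) (hf : f ∈ classA) :
    uiNorm Φ (analyticCalc f A + cfc (fun z => (starRingEnd ℂ) (f z)) B)
        ≤ ENNReal.ofReal (2 / (distCircle A * distCircle B)) * uiNorm Φ (1 - A * star B) ∧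
      uiNorm Φ (realPart (analyticCalc f A) : H →L[ℂ] H)
        ≤ ENNReal.ofReal (1 / distCircle A ^ 2) * uiNorm Φ (1 - A * star A) := by
  have hσA := Set.subset_union_left.trans hσ
  have hσB := Set.subset_union_right.trans hσ
  have hstar : cfc (fun z => (starRingEnd ℂ) (f z)) B = star (cfc f B) := cfc_star f B
  rw [analyticCalc_eq_cfc hA hσA hf.1, hstar]
  -- On the zero space `distCircle` is `0`, but both norms vanish there.
  rcases subsingleton_or_nontrivial H with hH | hH
  · have h0 : ∀ T : H →L[ℂ] H, uiNorm Φ T = 0 := fun T => by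
      rw [Subsingleton.elim T 0, uiNorm_zero]
    simp [h0]
  have hA0 := distCircle_pos hσA
  have hB0 := distCircle_pos hσB
  refine ⟨uiNorm_le_of_pairing_le Φ (by positivity) fun m e W he hW =>
    norm_pairing_add_star_le_of_mem_classA hA hB hσA hσB hf he hW,
    uiNorm_le_of_pairing_le Φ (by positivity) fun m e W he hW => ?_⟩
  have h := norm_pairing_add_star_le_of_mem_classA hA hA hσA hσA hf he hW
  have hre : ((realPart (cfc f A) : selfAdjoint (H →L[ℂ] H)) : H →L[ℂ] H)
      = (2⁻¹ : ℂ) • (cfc f A + star (cfc f A)) := by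
    rw [realPart_apply_coe, ← Complex.coe_smul]
    simp
  rw [hre, map_smul, norm_smul, norm_inv, Complex.norm_ofNat]
  calc _ ≤ 2⁻¹ * (2 / (distCircle A * distCircle A)
        * ∑ i ∈ Finset.range m, singVal (1 - A * star A) i) := by gcongr
    _ = _ := by field_simp
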